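/- Let $\bar S$ be a compact connected Riemann surface, $D\subset\bar S$ a finite set, and let $(E,\theta)$ be a logarithmic Higgs bundle of type $(1,1,1,1)$ on $\bar S$ with poles along $D$: $E=E^{3,0}\oplus E^{2,1}\oplus E^{1,2}\oplus E^{0,3}$ is a direct sum of holomorphic line bundles, and $\theta:E\to E\otimes\Omega^1_{\bar S}(\log D)$ is $\mathcal O_{\bar S}$-linear with $\theta(E^{i,j})\subset E^{i-1,j+1}\otimes\Omega^1_{\bar S}(\log D)$. Assume that $(E,\theta)$ is self-dual, i.e. there is a holomorphic, fibrewise nondegenerate bilinear pairing $Q:E\otimes E\to\mathcal O_{\bar S}$ with $Q(E^{p,q},E^{p',q'})=0$ unless $(p',q')=(q,p)$ and $Q(\theta a,b)+Q(a,\theta b)=0$. For $p\in D$ let $N_p\in\mathrm{End}(E_p)$ be the residue of $\theta$ at $p$, and let $W_\bullet$ be its monodromy weight filtration on the fibre $E_p$. The $L^2$-Higgs complex is given by the subsheaves $\Omega^0_{(2)}(E)\subset E$ and $\Omega^1_{(2)}(E)\subset E\otimes\Omega^1_{\bar S}(\log D)$ which are the full sheaves outside $D$ and which near $p\in D$, with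 local parameter $t$ at $p$, are $\Omega^0_{(2)}(E)=W_0+tE$ and $\Omega^1_{(2)}(E)=(W_{-2}+tE)\otimes\Omega^1_{\bar S}(\log D)$; here $W_k+tE$ is the sheaf of sections of $E$ whose value at $p$ lies in $W_k$. Its graded pieces are $\Omega^0_{(2)}(E)^{p,q}=\Omega^0_{(2)}(E)\cap E^{p,q}$ and $\Omega^1_{(2)}(E)^{p,q}=\Omega^1_{(2)}(E)\cap\bigl(E^{p,q}\otimes\Omega^1_{\bar S}(\log D)\bigr)$. A point $p\in D$ is of type $I$ if $N_p$ has Jordan blocks of sizes $2,1,1$, of type $II$ if it has Jordan blocks of sizes $2,2$, and of type $III$ if it has one Jordan block of size $4$. Then: 1. For every $p\in D$ one has $N_p^4=0$; the case $N_p^2\neq0$, $N_p^3=0$ does not occur; and either $N_p=0$ or $p$ is of type $I$, $II$ or $III$. The three types exclude each other. 2. $\Omega^0_{(2)}(E)$ and $\Omega^1_{(2)}(E)$ are the direct sums of their graded pieces. 3. Let $\mathcal O(-I)$, $\mathcal O(-II)$, $\mathcal O(-III)$ be the ideal sheaves of the points of type $I$, $II$, $III$. As subsheaves of $E^{p,q}$,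 $$\Omega^0_{(2)}(E)^{3,0}=E^{3,0}(-II-III),\quad \Omega^0_{(2)}(E)^{2,1}=E^{2,1}(-I-III),\quad \Omega^0_{(2)}(E)^{1,2}=E^{1,2}(-II),\quad \Omega^0_{(2)}(E)^{0,3}=E^{0,3},$$ and as subsheaves of $E^{p,q}\otimes\Omega^1_{\bar S}(\log D)$, $$\Omega^1_{(2)}(E)^{3,0}=E^{3,0}\otimes\Omega^1_{\bar S},\quad \Omega^1_{(2)}(E)^{2,1}=E^{2,1}\otimes\Omega^1_{\bar S},\quad \Omega^1_{(2)}(E)^{1,2}=E^{1,2}\otimes\Omega^1_{\bar S},\quad \Omega^1_{(2)}(E)^{0,3}=E^{0,3}(III)\otimes\Omega^1_{\bar S}.$$ -/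

import Mathlib

open scoped Manifold ContDiff Topology

noncomputable section

/-! ### The monodromy weight filtration of a nilpotent endomorphism -/

section WeightFiltration

variable {V : Type*} [AddCommGroup V] [Module ℂ V]

/-- `W` is a monodromy weight filtration of `N`: an increasing, finite and exhaustive filtration
with `N (W k) ⊆ W (k - 2)` such that `N ^ k` induces an isomorphism
`W k / W (k - 1) ≃ W (-k) / W (-k - 1)` for every `k ≥ 0` (the fields `gr_inj` and `gr_surj`). -/
structure IsWeightFiltration (N : Module.End ℂ V) (W : ℤ → Submodule ℂ V) : Prop where
  mono : Monotone W
  bot : ∃ m : ℕ, W (-(m : ℤ) - 1) = ⊥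
  top : ∃ m : ℕ, W (m : ℤ) = ⊤
  shift : ∀ k, ∀ x ∈ W k, N x ∈ W (k - 2)
  gr_inj : ∀ k : ℕ, ∀ x ∈ W (k : ℤ), (N ^ k) x ∈ W (-(k : ℤ) - 1) → x ∈ W ((k : ℤ) - 1)
  gr_surj : ∀ k : ℕ, ∀ y ∈ W (-(k : ℤ)), ∃ x ∈ W (k : ℤ), y - (N ^ k) x ∈ W (-(k : ℤ) - 1)

/-- The monodromy weight filtration of `N`, by the closed formula
`W k = ∑ i ≥ max 0 k, Ker (N ^ (i + 1)) ∩ Im (N ^ (i - k))`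
(the terms with `i < k` are contained in the term `i = k`). That this is the weight filtration
is `weightFiltration_spec` and `IsWeightFiltration.unique`. -/
def weightFiltration (N : Module.End ℂ V) (k : ℤ) : Submodule ℂ V :=
  ⨆ i : ℕ, LinearMap.ker (N ^ (i + 1)) ⊓ LinearMap.range (N ^ ((i : ℤ) - k).toNat)

theorem weightFiltration_term_le (N : Module.End ℂ V) (k : ℤ) (i : ℕ) :
    LinearMap.ker (N ^ (i + 1)) ⊓ LinearMap.range (N ^ ((i : ℤ) - k).toNat)
      ≤ weightFiltration N k :=
  le_iSup (fun i : ℕ => LinearMap.ker (N ^ (i + 1)) ⊓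
    LinearMap.range (N ^ ((i : ℤ) - k).toNat)) i

theorem weightFiltration_shift (N : Module.End ℂ V) :
    ∀ k, ∀ x ∈ weightFiltration N k, N x ∈ weightFiltration N (k - 2) := by
  intro k x hx
  suffices h : weightFiltration N k ≤ (weightFiltration N (k - 2)).comap N from h hx
  refine iSup_le fun i => ?_
  rintro _ ⟨hk, ⟨y, rfl⟩⟩
  rw [Submodule.mem_comap]
  rcases Nat.eq_zero_or_pos i with rfl | hi
  · have h0 : N ((N ^ (((0 : ℕ) : ℤ) - k).toNat) y) = 0 := by simpa using hk
    rw [h0]; exact Submodule.zero_mem _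
  · obtain ⟨j, rfl⟩ : ∃ j, i = j + 1 := ⟨i - 1, by omega⟩
    refine weightFiltration_term_le N (k - 2) j ⟨?_, ?_⟩
    · have h1 : (N ^ (j + 1 + 1)) ((N ^ (((j + 1 : ℕ) : ℤ) - k).toNat) y) = 0 := hk
      rw [pow_succ] at h1
      exact h1
    · by_cases hjk : ((j + 1 : ℕ) : ℤ) - k < 0
      · have : ((j : ℤ) - (k - 2)).toNat = 0 := by omega
        rw [this]; exact ⟨_, rfl⟩
      · have : ((j : ℤ) - (k - 2)).toNat = (((j + 1 : ℕ) : ℤ) - k).toNat + 1 := by omega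
        rw [this]
        exact ⟨y, by rw [pow_succ']; rfl⟩

/-- The closed formula satisfies the defining properties of the weight filtration. -/
theorem weightFiltration_spec (N : Module.End ℂ V) (hN : IsNilpotent N) :
    IsWeightFiltration N (weightFiltration N) := by
  obtain ⟨n, hn⟩ := hN
  have hpow : ∀ j, n ≤ j → N ^ j = 0 := fun j hj => pow_eq_zero_of_le hj hn
  have hmono : Monotone (weightFiltration N) := by
    intro a b hab
    refine iSup_le fun i => le_trans ?_ (weightFiltration_term_le N b i)
    refine inf_le_inf le_rfl ?_
    rintro _ ⟨y, rfl⟩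
    obtain ⟨d, hd⟩ : ∃ d, ((i : ℤ) - a).toNat = ((i : ℤ) - b).toNat + d :=
      ⟨((i : ℤ) - a).toNat - ((i : ℤ) - b).toNat, by omega⟩
    exact ⟨(N ^ d) y, by rw [hd, pow_add]; rfl⟩
  have hshift := weightFiltration_shift N
  have hneg : ∀ k : ℕ, ∀ y ∈ weightFiltration N (-(k : ℤ)),
      ∃ x ∈ weightFiltration N (k : ℤ), (N ^ k) x = y := by
    intro k y hy
    suffices h : weightFiltration N (-(k : ℤ)) ≤ (weightFiltration N (k : ℤ)).map (N ^ k) from h hy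
    refine iSup_le fun i => ?_
    rintro _ ⟨hk, ⟨y, rfl⟩⟩
    have e : ((i : ℤ) - -(k : ℤ)).toNat = k + i := by omega
    rw [e] at hk ⊢
    refine ⟨(N ^ i) y, weightFiltration_term_le N k (i + k) ⟨?_, ?_⟩, by rw [pow_add]; rfl⟩
    · have h1 : (N ^ (i + 1)) ((N ^ (k + i)) y) = 0 := hk
      have h2 : (N ^ (i + k + 1)) ((N ^ i) y) = 0 := by
        rw [← Module.End.mul_apply, ← pow_add] at h1 ⊢
        rwa [show i + k + 1 + i = i + 1 + (k + i) by omega]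
      exact h2
    · rw [show (((i + k : ℕ) : ℤ) - k).toNat = i by omega]; exact ⟨y, rfl⟩
  have hker : ∀ k : ℕ, ∀ x, (N ^ (k + 1)) x = 0 → x ∈ weightFiltration N (k : ℤ) := by
    intro k x hx
    refine weightFiltration_term_le N k k ⟨hx, ?_⟩
    rw [sub_self]; exact ⟨x, rfl⟩
  refine ⟨hmono, ⟨n, ?_⟩, ⟨n, ?_⟩, hshift, ?_, ?_⟩
  · rw [eq_bot_iff]
    refine iSup_le fun i => ?_
    rintro _ ⟨-, ⟨y, rfl⟩⟩
    rw [hpow _ (by omega)]; simp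
  · rw [eq_top_iff]
    intro x _
    exact hker n x (by rw [hpow _ (by omega)]; rfl)
  · intro k x hx hNx
    have hc : -(k : ℤ) - 1 = -((k + 1 : ℕ) : ℤ) := by push_cast; ring
    rw [hc] at hNx
    obtain ⟨y, hy, hyx⟩ := hneg (k + 1) _ hNx
    have hNy : N y ∈ weightFiltration N ((k : ℤ) - 1) := by
      have := hshift _ y hy
      rwa [show (((k + 1 : ℕ) : ℤ)) - 2 = (k : ℤ) - 1 by push_cast; ring] at this
    have hd : (N ^ k) (x - N y) = 0 := by
      rw [map_sub, sub_eq_zero, ← hyx, pow_succ]; rfl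
    have hd' : x - N y ∈ weightFiltration N ((k : ℤ) - 1) := by
      rcases Nat.eq_zero_or_pos k with rfl | hk
      · have : x - N y = 0 := by simpa using hd
        rw [this]; exact Submodule.zero_mem _
      · obtain ⟨j, rfl⟩ : ∃ j, k = j + 1 := ⟨k - 1, by omega⟩
        have := hker j _ hd
        rwa [show (((j + 1 : ℕ) : ℤ)) - 1 = (j : ℤ) by push_cast; ring]
    have := Submodule.add_mem _ hd' hNy
    rwa [sub_add_cancel] at this
  · intro k y hy
    obtain ⟨x, hx, rfl⟩ := hneg k y hy
    exact ⟨x, hx, by rw [sub_self]; exact Submodule.zero_mem _⟩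

/-- A nilpotent endomorphism has at most one weight filtration. -/
theorem IsWeightFiltration.unique {N : Module.End ℂ V} {W W' : ℤ → Submodule ℂ V}
    (hW : IsWeightFiltration N W) (hW' : IsWeightFiltration N W') : W = W' := by
  have hpow : ∀ {W : ℤ → Submodule ℂ V}, IsWeightFiltration N W → ∀ (j : ℕ) (k : ℤ), ∀ x ∈ W k,
      (N ^ j) x ∈ W (k - 2 * j) := by
    intro W h j
    induction j with
    | zero => intro k x hx; simpa using hx
    | succ j ih =>
      intro k x hx
      have := h.shift _ _ (ih k x hx)
      rw [pow_succ']
      rwa [show k - 2 * (j : ℤ) - 2 = k - 2 * ((j + 1 : ℕ) : ℤ) by push_cast; ring] at this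
  have hneg : ∀ {W : ℤ → Submodule ℂ V}, IsWeightFiltration N W → ∀ k : ℕ,
      W (-(k : ℤ)) = (W (k : ℤ)).map (N ^ k) := by
    intro W h k
    refine le_antisymm ?_ ?_
    · obtain ⟨m, hm⟩ := h.bot
      have key : ∀ d k : ℕ, m + 1 ≤ k + d → W (-(k : ℤ)) ≤ (W (k : ℤ)).map (N ^ k) := by
        intro d
        induction d with
        | zero =>
          intro k hk
          have : W (-(k : ℤ)) = ⊥ := le_bot_iff.1 (hm ▸ h.mono (by omega))
          rw [this]; exact bot_le
        | succ d ih =>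
          intro k hk y hy
          obtain ⟨x, hx, hxy⟩ := h.gr_surj k y hy
          rw [show -(k : ℤ) - 1 = -((k + 1 : ℕ) : ℤ) by push_cast; ring] at hxy
          obtain ⟨z, hz, hzy⟩ := ih (k + 1) (by omega) hxy
          refine ⟨x + N z, Submodule.add_mem _ hx (h.mono ?_ (h.shift _ z hz)), ?_⟩
          · push_cast; omega
          · have : (N ^ k) (N z) = y - (N ^ k) x := by rw [← hzy, pow_succ]; rfl
            rw [map_add, this]; abel
      exact key (m + 1) k (by omega)
    · rintro _ ⟨x, hx, rfl⟩
      have := hpow h k k x hx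
      rwa [show (k : ℤ) - 2 * k = -k by ring] at this
  have hpos : ∀ {W : ℤ → Submodule ℂ V}, IsWeightFiltration N W → ∀ k : ℕ,
      W (k : ℤ) = (W (-((k + 2 : ℕ) : ℤ))).comap (N ^ (k + 1)) := by
    intro W h k
    refine le_antisymm ?_ ?_
    · intro x hx
      have := hpow h (k + 1) k x hx
      rw [Submodule.mem_comap]
      rwa [show (k : ℤ) - 2 * ((k + 1 : ℕ) : ℤ) = -((k + 2 : ℕ) : ℤ) by push_cast; ring] at this
    · intro x hx
      rw [Submodule.mem_comap] at hx
      obtain ⟨m, hm⟩ := h.top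
      have key : ∀ d : ℕ, x ∈ W ((k + d : ℕ) : ℤ) → x ∈ W (k : ℤ) := by
        intro d
        induction d with
        | zero => exact fun hx => hx
        | succ d ih =>
          intro hd
          have h1 := hpow h d _ _ hx
          rw [← Module.End.mul_apply, ← pow_add, show d + (k + 1) = k + (d + 1) by ring] at h1
          have h2 := h.gr_inj (k + (d + 1)) x hd (h.mono (by push_cast; omega) h1)
          exact ih (h.mono (by push_cast; omega) h2)
      have hx' : x ∈ W (m : ℤ) := by rw [hm]; exact Submodule.mem_top
      exact key m (h.mono (by push_cast; omega) hx')
  obtain ⟨m, hm⟩ := hW.top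
  obtain ⟨m', hm'⟩ := hW'.top
  have hnat : ∀ d k : ℕ, m + m' ≤ k + d → W (k : ℤ) = W' (k : ℤ) := by
    intro d
    induction d with
    | zero =>
      intro k hk
      have h1 : W (m : ℤ) ≤ W (k : ℤ) := hW.mono (by omega)
      have h2 : W' (m' : ℤ) ≤ W' (k : ℤ) := hW'.mono (by omega)
      rw [hm] at h1
      rw [hm'] at h2
      rw [top_le_iff.1 h1, top_le_iff.1 h2]
    | succ d ih =>
      intro k hk
      rw [hpos hW, hpos hW', hneg hW, hneg hW', ih (k + 2) (by omega)]
  funext k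
  have hk := fun k : ℕ => hnat (m + m') k (by omega)
  rcases Int.eq_nat_or_neg k with ⟨n, rfl | rfl⟩
  · exact hk n
  · rw [hneg hW, hneg hW', hk]

end WeightFiltration

/-! ### Jordan types of the residue -/

section JordanType

variable {V : Type*} [AddCommGroup V] [Module ℂ V]

/-- Type I: Jordan form with a single nontrivial block, of size two. -/
def IsTypeI (N : Module.End ℂ V) : Prop :=
  ∃ b : Module.Basis (Fin 4) ℂ V, LinearMap.toMatrix b b N =
    !![0, 0, 0, 0;
       0, 0, 1, 0;
       0, 0, 0, 0;
       0, 0, 0, 0]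

/-- Type II: Jordan form with two blocks of size two. -/
def IsTypeII (N : Module.End ℂ V) : Prop :=
  ∃ b : Module.Basis (Fin 4) ℂ V, LinearMap.toMatrix b b N =
    !![0, 1, 0, 0;
       0, 0, 0, 0;
       0, 0, 0, 1;
       0, 0, 0, 0]

/-- Type III: Jordan form with one block of size four. -/
def IsTypeIII (N : Module.End ℂ V) : Prop :=
  ∃ b : Module.Basis (Fin 4) ℂ V, LinearMap.toMatrix b b N =
    !![0, 1, 0, 0;
       0, 0, 1, 0;
       0, 0, 0, 1;
       0, 0, 0, 0]

end JordanType

/-! ### Local coordinates, holomorphic sections of line bundles, twists -/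

section Sections

variable {S : Type*} [TopologicalSpace S] [ChartedSpace ℂ S]

/-- The local parameter `t` at `p` (with `t p = 0`) given by the preferred chart at `p`. -/
def localParam (p x : S) : ℂ := chartAt ℂ p x - chartAt ℂ p p

/-- The differential `dt` at `x` of the local parameter `t` at `p`. -/
def dLocalParam (p x : S) : TangentSpace 𝓘(ℂ) x →L[ℂ] ℂ := mvfderiv 𝓘(ℂ) (localParam p) x

/-- The coefficient of the generator at `p` of `Ω¹(Z)`: the form `dt / t` if `p ∈ Z`, and `dt`
otherwise, evaluated on a tangent vector at `x`. -/
def formGenerator (Z : Set S) (p x : S) (v : TangentSpace 𝓘(ℂ) x) : ℂ :=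
  open Classical in
  if p ∈ Z then dLocalParam p x v / localParam p x else dLocalParam p x v

section LineBundle

variable (L : S → Type*) [∀ x, AddCommGroup (L x)] [∀ x, Module ℂ (L x)]
  [∀ x, TopologicalSpace (L x)] [TopologicalSpace (Bundle.TotalSpace ℂ L)] [FiberBundle ℂ L]

/-- The section `s` of the line bundle `L` is holomorphic in a neighbourhood of `p`. -/
def HolAt (s : ∀ x, L x) (p : S) : Prop :=
  ContMDiffAt 𝓘(ℂ) (𝓘(ℂ).prod 𝓘(ℂ)) ω (fun x => (⟨x, s x⟩ : Bundle.TotalSpace ℂ L)) p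

/-- `Γ(U, L)`, the holomorphic sections of `L` over `U`. A section over `U` is represented by a
function on all of `S`, of which only the values on `U` are relevant. -/
def holSections (U : Set S) : Set (∀ x, L x) := {s | ∀ p ∈ U, HolAt L s p}

/-- `O(-Z)(U)`, where `O(-Z)` is the ideal sheaf of the set of points `Z`. -/
def idealSheaf (Z U : Set S) : Set (S → ℂ) :=
  {f | (∀ p ∈ U, ContMDiffAt 𝓘(ℂ) 𝓘(ℂ) ω f p) ∧ ∀ p ∈ U, p ∈ Z → f p = 0}

/-- `L(-Z)(U)`, where `L(-Z) = O(-Z) ⊗ L ⊆ L`: the sections over `U` that are locally products of a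
section of `O(-Z)` and a section of `L`. -/
def idealTwist (Z U : Set S) : Set (∀ x, L x) :=
  {s | ∀ p ∈ U, ∃ V ⊆ U, IsOpen V ∧ p ∈ V ∧ ∃ f ∈ idealSheaf Z V, ∃ e ∈ holSections L V,
    ∀ x ∈ V, s x = f x • e x}

/-- `(L(Z) ⊗ Ω¹)(U)` for a set of points `Z ⊆ D`: the `L`-valued one-forms `σ` that near every
`p ∈ U` are of the form `e ⊗ dt / t` (if `p ∈ Z`) or `e ⊗ dt` (if `p ∉ Z`) with `e` a holomorphic
section of `L`. A section over `U` of this sheaf is represented by its values outside `D`, which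
determine it: the values of `σ` outside `U \ D` are irrelevant. In particular
`Z = D` gives `L ⊗ Ω¹(log D)`, and `Z = ∅` gives `L ⊗ Ω¹`, all regarded as subsheaves of
`L ⊗ Ω¹(log D)`. -/
def twistedForms (D Z U : Set S) : Set (∀ x, TangentSpace 𝓘(ℂ) x →ₗ[ℂ] L x) :=
  {σ | ∀ p ∈ U, ∃ e : ∀ x, L x, HolAt L e p ∧
    ∀ᶠ x in 𝓝 p, x ∉ D → ∀ v, σ x v = formGenerator Z p x v • e x}

end LineBundle

end Sections

/-! ### Logarithmic Higgs bundles of type (1,1,1,1) and the L²-Higgs complex -/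

section Higgs

variable {S : Type*} [TopologicalSpace S] [ChartedSpace ℂ S]

/-- The section `s` of `E = ⨁ q, E q` is holomorphic in a neighbourhood of `p`. -/
def HolAtSum (E : Fin 4 → S → Type*) [∀ q x, AddCommGroup (E q x)] [∀ q x, Module ℂ (E q x)]
    [∀ q x, TopologicalSpace (E q x)] [∀ q, TopologicalSpace (Bundle.TotalSpace ℂ (E q))]
    [∀ q, FiberBundle ℂ (E q)] (s : ∀ x q, E q x) (p : S) : Prop :=
  ∀ q, HolAt (E q) (fun x => s x q) p

/-- A logarithmic Higgs bundle of type `(1,1,1,1)` with poles along `D`: a Higgs field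
`θ : E → E ⊗ Ω¹(log D)` on `E = ⨁ q, E q`, where the line bundle `E q` is `E^{3-q,q}`.
The field `θ` is given by its values outside `D`, as a one-form with values in `End E`
(its values at the points of `D` are irrelevant). -/
structure LogHiggsBundle (D : Set S) (E : Fin 4 → S → Type*)
    [∀ q x, AddCommGroup (E q x)] [∀ q x, Module ℂ (E q x)]
    [∀ q x, TopologicalSpace (E q x)] [∀ q, TopologicalSpace (Bundle.TotalSpace ℂ (E q))]
    [∀ q, FiberBundle ℂ (E q)] where
  /-- the Higgs field -/
  θ : ∀ x, TangentSpace 𝓘(ℂ) x →ₗ[ℂ] Module.End ℂ (∀ q, E q x)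
  /-- Near each `p`, `θ = A ⊗ dt / t` (if `p ∈ D`) or `θ = A ⊗ dt` (if `p ∉ D`) with `A` a
  holomorphic endomorphism of `E`. -/
  exists_coeff : ∀ p, ∃ A : ∀ x, Module.End ℂ (∀ q, E q x),
    (∀ s, HolAtSum E s p → HolAtSum E (fun x => A x (s x)) p) ∧
    ∀ᶠ x in 𝓝 p, x ∉ D → ∀ v, θ x v = formGenerator D p x v • A x
  /-- Griffiths transversality: `θ` maps `E^{i,j}` to `E^{i-1,j+1} ⊗ Ω¹(log D)`. -/
  transversal : ∀ x, x ∉ D → ∀ (v : TangentSpace 𝓘(ℂ) x) (q : Fin 4) (u : E q x) (q' : Fin 4),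
    (q' : ℕ) ≠ q + 1 → θ x v (Pi.single q u) q' = 0

namespace LogHiggsBundle

variable {D : Set S} {E : Fin 4 → S → Type*}
  [∀ q x, AddCommGroup (E q x)] [∀ q x, Module ℂ (E q x)]
  [∀ q x, TopologicalSpace (E q x)] [∀ q, TopologicalSpace (Bundle.TotalSpace ℂ (E q))]
  [∀ q, FiberBundle ℂ (E q)] (H : LogHiggsBundle D E)

/-- The residue of the Higgs field at `p ∈ D`: the value at `p` of the endomorphism `A` with
`θ = A ⊗ dt / t` near `p` (by continuity, `A p` is determined by `θ`). -/
def residue (p : S) : Module.End ℂ (∀ q, E q p) := (H.exists_coeff p).choose p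

/-- The logarithmic Higgs bundle is self-dual: there is a holomorphic nondegenerate pairing
`E ⊗ E → O` under which `E^{p,q}` is dual to `E^{q,p}`, and with
`Q (θ a) b + Q a (θ b) = 0`. -/
def IsSelfDual : Prop :=
  ∃ Q : ∀ x, LinearMap.BilinForm ℂ (∀ q, E q x),
    (∀ p s s', HolAtSum E s p → HolAtSum E s' p →
      ContMDiffAt 𝓘(ℂ) 𝓘(ℂ) ω (fun x => Q x (s x) (s' x)) p) ∧
    (∀ x, (Q x).Nondegenerate) ∧
    (∀ x (q q' : Fin 4) (u : E q x) (u' : E q' x), (q : ℕ) + q' ≠ 3 →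
      Q x (Pi.single q u) (Pi.single q' u') = 0) ∧
    (∀ x, x ∉ D → ∀ v a b, Q x (H.θ x v a) b + Q x a (H.θ x v b) = 0)

/-- The points of type I. -/
def pointsI : Set S := {p | p ∈ D ∧ IsTypeI (H.residue p)}

/-- The points of type II. -/
def pointsII : Set S := {p | p ∈ D ∧ IsTypeII (H.residue p)}

/-- The points of type III. -/
def pointsIII : Set S := {p | p ∈ D ∧ IsTypeIII (H.residue p)}

/-- `Ω⁰₍₂₎(E)(U)`, where `Ω⁰₍₂₎(E) ⊆ E` is equal to `E` outside `D` and to `W₀ + tE` near `p ∈ D`: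
the holomorphic sections of `E` whose value at every `p ∈ D` lies in `W₀` of the weight filtration
of the residue at `p`. -/
def L2Zero (U : Set S) : Set (∀ x q, E q x) :=
  {s | (∀ p ∈ U, HolAtSum E s p) ∧ ∀ p ∈ U, p ∈ D → s p ∈ weightFiltration (H.residue p) 0}

/-- `Ω¹₍₂₎(E)(U)`, where `Ω¹₍₂₎(E) ⊆ E ⊗ Ω¹(log D)` is equal to `E ⊗ Ω¹` outside `D` and to
`(W₋₂ + tE) ⊗ Ω¹(log D)` near `p ∈ D`: the `E`-valued forms that are `e ⊗ dt` near `p ∉ D`, and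
`e ⊗ dt / t` with `e p ∈ W₋₂` near `p ∈ D`, for a holomorphic section `e` of `E`. -/
def L2One (U : Set S) : Set (∀ x, TangentSpace 𝓘(ℂ) x →ₗ[ℂ] ∀ q, E q x) :=
  {σ | ∀ p ∈ U, ∃ e : ∀ x q, E q x, HolAtSum E e p ∧
    (p ∈ D → e p ∈ weightFiltration (H.residue p) (-2)) ∧
    ∀ᶠ x in 𝓝 p, x ∉ D → ∀ v, σ x v = formGenerator D p x v • e x}

/-- The Higgs field maps `Ω⁰₍₂₎(E)` to `Ω¹₍₂₎(E)`, so that these sheaves form a complex. -/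
theorem θ_mem_L2One {U : Set S} {s : ∀ x q, E q x} (hs : s ∈ H.L2Zero U) :
    (fun x => (H.θ x).flip (s x)) ∈ H.L2One U := by
  intro p hp
  obtain ⟨hA, hθ⟩ := (H.exists_coeff p).choose_spec
  refine ⟨fun x => (H.exists_coeff p).choose x (s x), hA s (hs.1 p hp), fun hD => ?_, ?_⟩
  · exact weightFiltration_shift (H.residue p) 0 _ (hs.2 p hp hD)
  · filter_upwards [hθ] with x hx hxD v
    change H.θ x v (s x) = _
    rw [hx hxD v]
    rfl

/-- `Ω⁰₍₂₎(E)^{3-q,q} = Ω⁰₍₂₎(E) ∩ E^{3-q,q}`, as a subsheaf of `E^{3-q,q}`. -/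
def L2ZeroPiece (q : Fin 4) (U : Set S) : Set (∀ x, E q x) :=
  {s | (fun x => (Pi.single q (s x) : ∀ q, E q x)) ∈ H.L2Zero U}

/-- `Ω¹₍₂₎(E)^{3-q,q} = Ω¹₍₂₎(E) ∩ (E^{3-q,q} ⊗ Ω¹(log D))`, as a subsheaf of
`E^{3-q,q} ⊗ Ω¹(log D)`. -/
def L2OnePiece (q : Fin 4) (U : Set S) : Set (∀ x, TangentSpace 𝓘(ℂ) x →ₗ[ℂ] E q x) :=
  {σ | (fun x => LinearMap.single ℂ (fun q => E q x) q ∘ₗ σ x) ∈ H.L2One U}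

end LogHiggsBundle

end Higgs

end

/-! The statement is local, and at a point `p ∈ D` it is linear algebra on a sum of four lines. In a
basis adapted to the grading the residue is a weighted shift with weights `a`, `β`, `c`: its other
matrix entries vanish because those of `θ` do off `D` and the entries are continuous
(`exists_isSelfDualShift_residue`). Skewness for the first and third basis vectors reads `a * Q (b
1) (b 2) + c * Q (b 0) (b 3) = 0` with both pairings nonzero, so `a = 0 ↔ c = 0`.

Only the vanishing of `a` and `β` then matters: both zero gives `N = 0`, only `a = 0` type I, only
`β = 0` type II, neither type III. In each case the basis vectors are homogeneous for the weight
filtration, with weights `0,1,-1,0` (I), `1,-1,1,-1` (II) and `3,1,-1,-3` (III). Hence `W₀` and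
`W₋₂` are spanned by basis vectors, which gives both the splitting of the complex and the table of
vanishing conditions.

Vanishing conditions become twists because a holomorphic section vanishing at `p` is divisible by
the local parameter `t` (`HolAt.exists_eventually_eq_localParam_smul`): in degree zero this yields
`E(-Z)`, in degree one it turns `e ⊗ dt / t` with `e p = 0` into `e' ⊗ dt`. -/

noncomputable section

set_option linter.unusedSectionVars false

/-! ### Linear algebra of weighted shifts: Jordan types and weight filtration -/

section ShiftEndomorphism

variable {V : Type*} [AddCommGroup V] [Module ℂ V]

/-- In the basis `b`, the endomorphism `N` is a weighted shift with weights `a`, `β`, `c`, where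
`a` and `c` vanish simultaneously. -/
structure IsSelfDualShift (b : Module.Basis (Fin 4) ℂ V) (N : Module.End ℂ V) (a β c : ℂ) :
    Prop where
  map_zero : N (b 0) = a • b 1
  map_one : N (b 1) = β • b 2
  map_two : N (b 2) = c • b 3
  map_three : N (b 3) = 0
  eq_zero_iff : a = 0 ↔ c = 0

theorem Module.Basis.apply_eq_sum_of_toMatrix_eq {ι : Type*} [Fintype ι] [DecidableEq ι]
    (b : Module.Basis ι ℂ V) {N : Module.End ℂ V} {M : Matrix ι ι ℂ}
    (h : LinearMap.toMatrix b b N = M) (i : ι) : N (b i) = ∑ j, M j i • b j := by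
  rw [← Matrix.toLin_self b b M i, ← h, Matrix.toLin_toMatrix]

/-- An endomorphism with a Jordan block of size two and two blocks of size one has square zero and
rank one. -/
theorem IsTypeI.sq_eq_zero_and_range {N : Module.End ℂ V} (h : IsTypeI N) :
    N ≠ 0 ∧ N ^ 2 = 0 ∧ ∃ d : V, ∀ v, ∃ x : ℂ, N v = x • d := by
  obtain ⟨b, hb⟩ := h
  have e : ∀ i, N (b i) = if i = 2 then b 1 else 0 := by
    intro i
    rw [b.apply_eq_sum_of_toMatrix_eq hb]
    fin_cases i <;> simp [Fin.sum_univ_four]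
  have hv : ∀ v, N v = b.repr v 2 • b 1 := by
    intro v
    conv_lhs => rw [← b.sum_repr v]
    simp only [map_sum, map_smul, e, smul_ite, smul_zero, Finset.sum_ite_eq', Finset.mem_univ,
      if_true]
  refine ⟨fun h0 => ?_, ?_, b 1, fun v => ⟨_, hv v⟩⟩
  · have := e 2
    rw [h0] at this
    exact b.ne_zero 1 (by simpa using this.symm)
  · ext v
    rw [pow_two, Module.End.mul_apply, hv v, map_smul, e]
    simp

/-- The image contains the independent vectors `b 0` and `b 2`. The rank is what separates this type
from type I, since both have square zero. -/
theorem IsTypeII.sq_eq_zero_and_range {N : Module.End ℂ V} (h : IsTypeII N) :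
    N ≠ 0 ∧ N ^ 2 = 0 ∧ ¬ ∃ d : V, ∀ v, ∃ x : ℂ, N v = x • d := by
  obtain ⟨b, hb⟩ := h
  have e0 : N (b 0) = 0 := by rw [b.apply_eq_sum_of_toMatrix_eq hb]; simp [Fin.sum_univ_four]
  have e1 : N (b 1) = b 0 := by rw [b.apply_eq_sum_of_toMatrix_eq hb]; simp [Fin.sum_univ_four]
  have e2 : N (b 2) = 0 := by rw [b.apply_eq_sum_of_toMatrix_eq hb]; simp [Fin.sum_univ_four]
  have e3 : N (b 3) = b 2 := by rw [b.apply_eq_sum_of_toMatrix_eq hb]; simp [Fin.sum_univ_four]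
  refine ⟨fun h0 => ?_, ?_, ?_⟩
  · rw [h0] at e1
    exact b.ne_zero 0 (by simpa using e1.symm)
  · refine b.ext fun i => ?_
    rw [pow_two, Module.End.mul_apply]
    fin_cases i <;> simp [e0, e1, e2, e3]
  · rintro ⟨d, hd⟩
    obtain ⟨x, hx⟩ := hd (b 1)
    obtain ⟨y, hy⟩ := hd (b 3)
    rw [e1] at hx
    rw [e3] at hy
    -- Both terms equal `(x * y) • d`; the coordinate along `b 0` then forces `y = 0`.
    have h1 : y • b 0 - x • b 2 = 0 := by rw [hx, hy, smul_smul, smul_smul, mul_comm, sub_self]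
    have h2 := congrArg (fun v => b.repr v 0) h1
    have hy0 : y = 0 := by simpa using h2
    exact b.ne_zero 2 (by rw [hy, hy0, zero_smul])

theorem IsTypeIII.sq_ne_zero {N : Module.End ℂ V} (h : IsTypeIII N) : N ^ 2 ≠ 0 := by
  obtain ⟨b, hb⟩ := h
  have e1 : N (b 1) = b 0 := by rw [b.apply_eq_sum_of_toMatrix_eq hb]; simp [Fin.sum_univ_four]
  have e2 : N (b 2) = b 1 := by rw [b.apply_eq_sum_of_toMatrix_eq hb]; simp [Fin.sum_univ_four]
  intro h0
  have := congrArg (fun M : Module.End ℂ V => M (b 2)) h0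
  simp only [pow_two, Module.End.mul_apply, e2, e1] at this
  exact b.ne_zero 0 this

theorem IsTypeI.not_isTypeII {N : Module.End ℂ V} (h : IsTypeI N) : ¬ IsTypeII N :=
  fun h' => h'.sq_eq_zero_and_range.2.2 h.sq_eq_zero_and_range.2.2

theorem IsTypeI.not_isTypeIII {N : Module.End ℂ V} (h : IsTypeI N) : ¬ IsTypeIII N :=
  fun h' => h'.sq_ne_zero h.sq_eq_zero_and_range.2.1

theorem IsTypeII.not_isTypeIII {N : Module.End ℂ V} (h : IsTypeII N) : ¬ IsTypeIII N :=
  fun h' => h'.sq_ne_zero h.sq_eq_zero_and_range.2.1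

namespace IsSelfDualShift

variable {b : Module.Basis (Fin 4) ℂ V} {N : Module.End ℂ V} {a β c : ℂ}

theorem apply_eq (h : IsSelfDualShift b N a β c) (v : V) :
    N v = (a * b.repr v 0) • b 1 + (β * b.repr v 1) • b 2 + (c * b.repr v 2) • b 3 := by
  conv_lhs => rw [← b.sum_repr v]
  simp only [Fin.sum_univ_four, map_add, map_smul, h.map_zero, h.map_one, h.map_two, h.map_three,
    smul_smul, smul_zero, add_zero, mul_comm]

theorem repr_apply (h : IsSelfDualShift b N a β c) (v : V) :
    b.repr (N v) 0 = 0 ∧ b.repr (N v) 1 = a * b.repr v 0 ∧ b.repr (N v) 2 = β * b.repr v 1 ∧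
      b.repr (N v) 3 = c * b.repr v 2 := by
  rw [h.apply_eq]
  simp

theorem repr_sq_apply (h : IsSelfDualShift b N a β c) (v : V) :
    b.repr ((N ^ 2) v) 0 = 0 ∧ b.repr ((N ^ 2) v) 1 = 0 ∧
      b.repr ((N ^ 2) v) 2 = β * (a * b.repr v 0) ∧
      b.repr ((N ^ 2) v) 3 = c * (β * b.repr v 1) := by
  obtain ⟨h0, h1, h2, h3⟩ := h.repr_apply (N v)
  obtain ⟨k0, k1, k2, k3⟩ := h.repr_apply v
  rw [pow_two, Module.End.mul_apply]
  rw [k0] at h1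
  rw [k1] at h2
  rw [k2] at h3
  exact ⟨h0, by simpa using h1, h2, h3⟩

theorem repr_cube_apply (h : IsSelfDualShift b N a β c) (v : V) :
    b.repr ((N ^ 3) v) 0 = 0 ∧ b.repr ((N ^ 3) v) 1 = 0 ∧ b.repr ((N ^ 3) v) 2 = 0 ∧
      b.repr ((N ^ 3) v) 3 = c * (β * (a * b.repr v 0)) := by
  obtain ⟨h0, h1, h2, h3⟩ := h.repr_sq_apply (N v)
  obtain ⟨k0, k1, -, -⟩ := h.repr_apply v
  rw [pow_succ, Module.End.mul_apply]
  rw [k0] at h2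
  rw [k1] at h3
  exact ⟨h0, h1, by simpa using h2, h3⟩

theorem pow_four (h : IsSelfDualShift b N a β c) : N ^ 4 = 0 := by
  ext v
  obtain ⟨h0, h1, h2, h3⟩ := h.repr_cube_apply (N v)
  rw [(h.repr_apply v).1] at h3
  rw [pow_succ, Module.End.mul_apply, LinearMap.zero_apply]
  refine b.repr.map_eq_zero_iff.1 (Finsupp.ext fun i => ?_)
  fin_cases i
  · exact h0
  · exact h1
  · exact h2
  · simpa using h3

theorem eq_zero (h : IsSelfDualShift b N a β c) (ha : a = 0) (hβ : β = 0) : N = 0 := by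
  ext v
  rw [h.apply_eq, ha, hβ, h.eq_zero_iff.1 ha]
  simp

/-- The entries of `N ^ 2` are `β * a` and `c * β`, and `a = 0` forces `c = 0`. Together with
`cube_ne_zero` this is how self-duality excludes a Jordan block of size three. -/
theorem sq_eq_zero (h : IsSelfDualShift b N a β c) (hz : a = 0 ∨ β = 0) : N ^ 2 = 0 := by
  ext v
  obtain ⟨h0, h1, h2, h3⟩ := h.repr_sq_apply v
  rw [LinearMap.zero_apply]
  refine b.repr.map_eq_zero_iff.1 (Finsupp.ext fun i => ?_)
  have hc := h.eq_zero_iff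
  fin_cases i
  · exact h0
  · exact h1
  · rcases hz with hz | hz <;> simpa [hz] using h2
  · rcases hz with hz | hz
    · simpa [hc.1 hz] using h3
    · simpa [hz] using h3

theorem cube_ne_zero (h : IsSelfDualShift b N a β c) (ha : a ≠ 0) (hβ : β ≠ 0) : N ^ 3 ≠ 0 := by
  intro h0
  have hc : c ≠ 0 := fun hc => ha (h.eq_zero_iff.2 hc)
  have := (h.repr_cube_apply (b 0)).2.2.2
  rw [h0] at this
  simp [ha, hβ, hc] at this

theorem isTypeI_of (h : IsSelfDualShift b N a β c) (ha : a = 0) (hβ : β ≠ 0) : IsTypeI N := by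
  have hw : ∀ i, IsUnit (![1, 1, β, 1] i) := by
    intro i; fin_cases i <;> simp [hβ]
  have hc := h.eq_zero_iff.1 ha
  have h0 := h.map_zero
  have h1 := h.map_one
  have h2 := h.map_two
  have h3 := h.map_three
  -- The Jordan basis is `b 0, β • b 2, b 1, b 3`.
  refine ⟨(b.isUnitSMul hw).reindex (Equiv.swap 1 2), ?_⟩
  rw [← LinearEquiv.eq_symm_apply, LinearMap.toMatrix_symm]
  refine Module.Basis.ext ((b.isUnitSMul hw).reindex (Equiv.swap 1 2)) fun i => ?_
  rw [Matrix.toLin_self, Fin.sum_univ_four]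
  fin_cases i <;>
    simp [Module.Basis.isUnitSMul_apply, h0, h1, h2, h3, ha, hc, Equiv.swap_apply_def]

theorem isTypeII_of (h : IsSelfDualShift b N a β c) (ha : a ≠ 0) (hβ : β = 0) : IsTypeII N := by
  have hc : c ≠ 0 := fun hc => ha (h.eq_zero_iff.2 hc)
  have hw : ∀ i, IsUnit (![1, a, 1, c] i) := by
    intro i; fin_cases i <;> simp [ha, hc]
  have h0 := h.map_zero
  have h1 := h.map_one
  have h2 := h.map_two
  have h3 := h.map_three
  -- The Jordan basis is `a • b 1, b 0, c • b 3, b 2`.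
  refine ⟨(b.isUnitSMul hw).reindex (Equiv.swap 0 1 * Equiv.swap 2 3), ?_⟩
  rw [← LinearEquiv.eq_symm_apply, LinearMap.toMatrix_symm]
  refine Module.Basis.ext
    ((b.isUnitSMul hw).reindex (Equiv.swap 0 1 * Equiv.swap 2 3)) fun i => ?_
  rw [Matrix.toLin_self, Fin.sum_univ_four]
  have e0 : (Equiv.swap 0 1 * Equiv.swap 2 3 : Equiv.Perm (Fin 4)).symm 0 = 1 := by decide
  have e1 : (Equiv.swap 0 1 * Equiv.swap 2 3 : Equiv.Perm (Fin 4)).symm 1 = 0 := by decide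
  have e2 : (Equiv.swap 0 1 * Equiv.swap 2 3 : Equiv.Perm (Fin 4)).symm 2 = 3 := by decide
  have e3 : (Equiv.swap 0 1 * Equiv.swap 2 3 : Equiv.Perm (Fin 4)).symm 3 = 2 := by decide
  fin_cases i <;>
    simp [Module.Basis.isUnitSMul_apply, h0, h1, h2, h3, hβ, e0, e1, e2, e3]

theorem isTypeIII_of (h : IsSelfDualShift b N a β c) (ha : a ≠ 0) (hβ : β ≠ 0) :
    IsTypeIII N := by
  have hc : c ≠ 0 := fun hc => ha (h.eq_zero_iff.2 hc)
  have hw : ∀ i, IsUnit (![1, a, a * β, a * β * c] i) := by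
    intro i; fin_cases i <;> simp [ha, hβ, hc]
  have h0 := h.map_zero
  have h1 := h.map_one
  have h2 := h.map_two
  have h3 := h.map_three
  -- The rescaled vectors are the iterates `(N ^ k) (b 0)`; they are reversed because the model
  -- matrix lowers the index.
  refine ⟨(b.isUnitSMul hw).reindex Fin.revPerm, ?_⟩
  rw [← LinearEquiv.eq_symm_apply, LinearMap.toMatrix_symm]
  refine Module.Basis.ext ((b.isUnitSMul hw).reindex Fin.revPerm) fun i => ?_
  rw [Matrix.toLin_self, Fin.sum_univ_four]
  fin_cases i <;>
    simp [Module.Basis.isUnitSMul_apply, h0, h1, h2, h3, Fin.rev, smul_smul]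

/-- The four cases for `a` and `β` are exhaustive and the types exclude each other, so the
constructions of Jordan bases also give the converse. -/
theorem isTypeI_iff (h : IsSelfDualShift b N a β c) : IsTypeI N ↔ a = 0 ∧ β ≠ 0 := by
  refine ⟨fun hI => ?_, fun hz => h.isTypeI_of hz.1 hz.2⟩
  by_cases ha : a = 0
  · exact ⟨ha, fun hβ => hI.sq_eq_zero_and_range.1 (h.eq_zero ha hβ)⟩
  · by_cases hβ : β = 0
    · exact (hI.not_isTypeII (h.isTypeII_of ha hβ)).elim
    · exact (hI.not_isTypeIII (h.isTypeIII_of ha hβ)).elim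

theorem isTypeII_iff (h : IsSelfDualShift b N a β c) : IsTypeII N ↔ a ≠ 0 ∧ β = 0 := by
  refine ⟨fun hII => ?_, fun hz => h.isTypeII_of hz.1 hz.2⟩
  by_cases ha : a = 0
  · by_cases hβ : β = 0
    · exact (hII.sq_eq_zero_and_range.1 (h.eq_zero ha hβ)).elim
    · exact ((h.isTypeI_of ha hβ).not_isTypeII hII).elim
  · exact ⟨ha, by_contra fun hβ => hII.not_isTypeIII (h.isTypeIII_of ha hβ)⟩

theorem isTypeIII_iff (h : IsSelfDualShift b N a β c) : IsTypeIII N ↔ a ≠ 0 ∧ β ≠ 0 := by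
  refine ⟨fun hIII => ⟨fun ha => ?_, fun hβ => ?_⟩, fun hz => h.isTypeIII_of hz.1 hz.2⟩
  · exact hIII.sq_ne_zero (h.sq_eq_zero (Or.inl ha))
  · exact hIII.sq_ne_zero (h.sq_eq_zero (Or.inr hβ))

theorem eq_zero_or_isType (h : IsSelfDualShift b N a β c) :
    N = 0 ∨ IsTypeI N ∨ IsTypeII N ∨ IsTypeIII N := by
  rw [h.isTypeI_iff, h.isTypeII_iff, h.isTypeIII_iff]
  by_cases ha : a = 0 <;> by_cases hβ : β = 0
  · exact Or.inl (h.eq_zero ha hβ)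
  all_goals simp [ha, hβ]

theorem repr_eq_zero_of_mem_ker (h : IsSelfDualShift b N a β c) {v : V} (hv : N v = 0) :
    a * b.repr v 0 = 0 ∧ β * b.repr v 1 = 0 ∧ c * b.repr v 2 = 0 := by
  obtain ⟨-, h1, h2, h3⟩ := h.repr_apply v
  rw [hv] at h1 h2 h3
  exact ⟨by simpa using h1.symm, by simpa using h2.symm, by simpa using h3.symm⟩

/-- `W₀` of a self-dual shift in coordinates. -/
theorem mem_weightFiltration_zero_iff (h : IsSelfDualShift b N a β c) (v : V) :
    v ∈ weightFiltration N 0 ↔ (a ≠ 0 → b.repr v 0 = 0) ∧ (β ≠ 0 → b.repr v 1 = 0) ∧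
      (a ≠ 0 → β = 0 → b.repr v 2 = 0) := by
  have hac := h.eq_zero_iff
  constructor
  · intro hv
    -- The coordinate conditions cut out a subspace, so they need checking only on each term of the
    -- supremum defining the filtration.
    let P : Submodule ℂ V :=
      { carrier := {v | (a ≠ 0 → b.repr v 0 = 0) ∧ (β ≠ 0 → b.repr v 1 = 0) ∧
          (a ≠ 0 → β = 0 → b.repr v 2 = 0)}
        zero_mem' := by simp
        add_mem' := by
          rintro v w ⟨h0, h1, h2⟩ ⟨k0, k1, k2⟩
          exact ⟨fun ha => by simp [h0 ha, k0 ha], fun hβ => by simp [h1 hβ, k1 hβ],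
            fun ha hβ => by simp [h2 ha hβ, k2 ha hβ]⟩
        smul_mem' := by
          rintro x v ⟨h0, h1, h2⟩
          exact ⟨fun ha => by simp [h0 ha], fun hβ => by simp [h1 hβ],
            fun ha hβ => by simp [h2 ha hβ]⟩ }
    suffices hle : weightFiltration N 0 ≤ P from hle hv
    refine iSup_le fun i => ?_
    rintro _ ⟨hk, ⟨y, rfl⟩⟩
    have e : ((i : ℤ) - 0).toNat = i := by simp
    rw [e] at hk ⊢
    match i, hk with
    | 0, hk =>
      have hk' : N y = 0 := by simpa using hk
      obtain ⟨h0, h1, h2⟩ := h.repr_eq_zero_of_mem_ker hk'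
      refine ⟨fun ha => ?_, fun hβ => ?_, fun ha _ => ?_⟩
      · simpa [ha] using h0
      · simpa [hβ] using h1
      · simpa [mt hac.2 ha] using h2
    | 1, hk =>
      -- Here the vector is `N y` with `N ^ 2` killing it, so `c * β * a` annihilates the coordinate
      -- `0` of `y`.
      have hk' : (N ^ 3) y = 0 := by
        rw [pow_succ]
        simpa using hk
      obtain ⟨h0, h1, h2, -⟩ := h.repr_apply y
      have h3 := (h.repr_cube_apply y).2.2.2
      rw [hk'] at h3
      rw [pow_one]
      refine ⟨fun _ => h0, fun hβ => ?_, fun _ hβ => by rw [h2, hβ, zero_mul]⟩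
      rw [h1]
      by_cases ha : a = 0
      · rw [ha, zero_mul]
      · simpa [hβ, mt hac.2 ha] using h3.symm
    | 2, hk =>
      obtain ⟨h0, h1, h2, -⟩ := h.repr_sq_apply y
      exact ⟨fun _ => h0, fun _ => h1, fun _ hβ => by rw [h2, hβ, zero_mul]⟩
    | i + 3, hk =>
      obtain ⟨h0, h1, h2, -⟩ := h.repr_cube_apply ((N ^ i) y)
      rw [← Module.End.mul_apply, ← pow_add, add_comm 3 i] at h0 h1 h2
      exact ⟨fun _ => h0, fun _ => h1, fun _ _ => h2⟩
  · rintro ⟨h0, h1, h2⟩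
    have hker : ∀ w, N w = 0 → w ∈ weightFiltration N 0 := fun w hw =>
      weightFiltration_term_le N 0 0 ⟨by simpa using hw, by simp⟩
    rw [← b.sum_repr v, Fin.sum_univ_four]
    refine add_mem (add_mem (add_mem ?_ ?_) ?_)
      (Submodule.smul_mem _ _ (hker _ h.map_three))
    · by_cases ha : a = 0
      · exact Submodule.smul_mem _ _ (hker _ (by rw [h.map_zero, ha, zero_smul]))
      · rw [h0 ha, zero_smul]; exact zero_mem _
    · by_cases hβ : β = 0
      · exact Submodule.smul_mem _ _ (hker _ (by rw [h.map_one, hβ, zero_smul]))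
      · rw [h1 hβ, zero_smul]; exact zero_mem _
    · by_cases ha : a = 0
      · exact Submodule.smul_mem _ _ (hker _ (by rw [h.map_two, hac.1 ha, zero_smul]))
      · by_cases hβ : β = 0
        · rw [h2 ha hβ, zero_smul]; exact zero_mem _
        · refine Submodule.smul_mem _ _ (weightFiltration_term_le N 0 1 ⟨?_, ?_⟩)
          · simp [pow_two, h.map_two, h.map_three]
          · refine ⟨β⁻¹ • b 1, ?_⟩
            simp [h.map_one, smul_smul, hβ]

/-- `W₋₂` of a self-dual shift in coordinates. -/
theorem mem_weightFiltration_neg_two_iff (h : IsSelfDualShift b N a β c) (v : V) :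
    v ∈ weightFiltration N (-2) ↔ b.repr v 0 = 0 ∧ b.repr v 1 = 0 ∧ b.repr v 2 = 0 ∧
      (¬ (a ≠ 0 ∧ β ≠ 0) → b.repr v 3 = 0) := by
  have hac := h.eq_zero_iff
  constructor
  · intro hv
    let P : Submodule ℂ V :=
      { carrier := {v | b.repr v 0 = 0 ∧ b.repr v 1 = 0 ∧ b.repr v 2 = 0 ∧
          (¬ (a ≠ 0 ∧ β ≠ 0) → b.repr v 3 = 0)}
        zero_mem' := by simp
        add_mem' := by
          rintro v w ⟨h0, h1, h2, h3⟩ ⟨k0, k1, k2, k3⟩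
          exact ⟨by simp [h0, k0], by simp [h1, k1], by simp [h2, k2],
            fun hz => by simp [h3 hz, k3 hz]⟩
        smul_mem' := by
          rintro x v ⟨h0, h1, h2, h3⟩
          exact ⟨by simp [h0], by simp [h1], by simp [h2], fun hz => by simp [h3 hz]⟩ }
    suffices hle : weightFiltration N (-2) ≤ P from hle hv
    refine iSup_le fun i => ?_
    rintro _ ⟨hk, ⟨y, rfl⟩⟩
    have e : ((i : ℤ) - -2).toNat = i + 2 := by omega
    rw [e] at hk ⊢
    -- Every term lies in the image of `N ^ 2`, which is zero outside type III.
    have hzero : ¬ (a ≠ 0 ∧ β ≠ 0) → b.repr ((N ^ (i + 2)) y) 3 = 0 := by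
      intro hz
      rw [pow_add, h.sq_eq_zero (by tauto)]
      simp
    match i, hk with
    | 0, hk =>
      obtain ⟨h0, h1, h2, -⟩ := h.repr_sq_apply y
      have hk' : N ((N ^ 2) y) = 0 := by simpa using hk
      obtain ⟨-, -, k2⟩ := h.repr_eq_zero_of_mem_ker hk'
      refine ⟨h0, h1, ?_, hzero⟩
      rw [zero_add]
      by_cases ha : a = 0
      · rw [h2, ha]; simp
      · simpa [mt hac.2 ha] using k2
    | i + 1, hk =>
      obtain ⟨h0, h1, h2, -⟩ := h.repr_cube_apply ((N ^ i) y)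
      rw [← Module.End.mul_apply, ← pow_add, show 3 + i = i + 1 + 2 by ring] at h0 h1 h2
      exact ⟨h0, h1, h2, hzero⟩
  · rintro ⟨h0, h1, h2, h3⟩
    rw [← b.sum_repr v, Fin.sum_univ_four, h0, h1, h2]
    simp only [zero_smul, zero_add]
    by_cases hz : a ≠ 0 ∧ β ≠ 0
    · have hc : c ≠ 0 := mt hac.2 hz.1
      -- In type III, `b 3` is `N ^ 2` of a multiple of `b 1` and is killed by `N`: the term `i =
      -- 0`.
      refine Submodule.smul_mem _ _ (weightFiltration_term_le N (-2) 0 ⟨?_, ?_⟩)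
      · simp [h.map_three]
      · refine ⟨(c⁻¹ * β⁻¹) • b 1, ?_⟩
        have e : c⁻¹ * β⁻¹ * (β * c) = 1 := by
          have := hz.2
          field_simp
        simp [pow_two, h.map_one, h.map_two, smul_smul, e]
    · rw [h3 hz, zero_smul]; exact zero_mem _

end IsSelfDualShift

/-- A degree one endomorphism that is skew for a nondegenerate bilinear form pairing `b q` with
`b (3 - q)` is a self-dual shift. -/
theorem exists_isSelfDualShift (b : Module.Basis (Fin 4) ℂ V) (N : Module.End ℂ V)
    (hN : ∀ q q' : Fin 4, (q' : ℕ) ≠ q + 1 → b.repr (N (b q)) q' = 0)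
    (Q : LinearMap.BilinForm ℂ V) (hQ : Q.Nondegenerate)
    (hQb : ∀ q q' : Fin 4, (q : ℕ) + q' ≠ 3 → Q (b q) (b q') = 0)
    (hskew : ∀ v w, Q (N v) w + Q v (N w) = 0) :
    ∃ a β c : ℂ, IsSelfDualShift b N a β c := by
  have h0 : N (b 0) = b.repr (N (b 0)) 1 • b 1 := by
    conv_lhs => rw [← b.sum_repr (N (b 0)), Fin.sum_univ_four, hN 0 0 (by simp),
      hN 0 2 (by simp), hN 0 3 (by simp)]
    simp
  have h1 : N (b 1) = b.repr (N (b 1)) 2 • b 2 := by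
    conv_lhs => rw [← b.sum_repr (N (b 1)), Fin.sum_univ_four, hN 1 0 (by simp),
      hN 1 1 (by simp), hN 1 3 (by simp)]
    simp
  have h2 : N (b 2) = b.repr (N (b 2)) 3 • b 3 := by
    conv_lhs => rw [← b.sum_repr (N (b 2)), Fin.sum_univ_four, hN 2 0 (by simp),
      hN 2 1 (by simp), hN 2 2 (by simp)]
    simp
  have h3 : N (b 3) = 0 := by
    rw [← b.sum_repr (N (b 3)), Fin.sum_univ_four, hN 3 0 (by simp), hN 3 1 (by simp),
      hN 3 2 (by simp), hN 3 3 (by simp)]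
    simp
  -- Otherwise `b q` would pair to zero with the whole basis, against nondegeneracy.
  have hne : ∀ q q' : Fin 4, (q : ℕ) + q' = 3 → Q (b q) (b q') ≠ 0 := by
    intro q q' hq h
    refine b.ne_zero q (hQ.1 _ fun w => ?_)
    suffices hz : Q (b q) = 0 by rw [hz]; rfl
    refine b.ext fun j => ?_
    by_cases hj : (q : ℕ) + j = 3
    · rw [show j = q' from Fin.ext (by omega), h]; rfl
    · rw [hQb q j hj]; rfl
  refine ⟨_, _, _, h0, h1, h2, h3, ?_⟩
  -- This is the relation `a * Q (b 1) (b 2) + c * Q (b 0) (b 3) = 0`.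
  have hs := hskew (b 0) (b 2)
  rw [h0, h2] at hs
  simp only [map_smul, LinearMap.smul_apply, smul_eq_mul] at hs
  have hne12 := hne 1 2 (by simp)
  have hne03 := hne 0 3 (by simp)
  constructor <;> intro hz <;> rw [hz] at hs
  · simpa [hne03] using hs
  · simpa [hne12] using hs

end ShiftEndomorphism

/-! ### The local parameter and its differential -/

section LocalParameter

variable {S : Type*} [TopologicalSpace S] [ChartedSpace ℂ S]

theorem localParam_self (p : S) : localParam p p = 0 := sub_self _

theorem localParam_ne_zero {p x : S} (hx : x ∈ (chartAt ℂ p).source) (hxp : x ≠ p) :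
    localParam p x ≠ 0 := fun h =>
  hxp ((chartAt ℂ p).injOn hx (mem_chart_source ℂ p) (sub_eq_zero.1 h))

/-- A chart would map an isolated point to an open singleton of `ℂ`. This makes values at `p` limits
of values at nearby points. -/
theorem nhdsNE_neBot_of_chartedSpace (p : S) : (𝓝[≠] p).NeBot := by
  rw [Filter.neBot_iff, Ne, ← isOpen_singleton_iff_punctured_nhds]
  intro h
  have := (chartAt ℂ p).isOpen_image_of_subset_source h
    (Set.singleton_subset_iff.2 (mem_chart_source ℂ p))
  rw [Set.image_singleton] at this
  exact not_isOpen_singleton _ this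

variable [IsManifold 𝓘(ℂ) ω S]

theorem contMDiffAt_localParam {p x : S} (hx : x ∈ (chartAt ℂ p).source) :
    ContMDiffAt 𝓘(ℂ) 𝓘(ℂ) ω (localParam p) x :=
  (contMDiffAt_of_mem_maximalAtlas (IsManifold.chart_mem_maximalAtlas p) hx).sub
    contMDiffAt_const

/-- The derivative of a chart is invertible. Such a vector allows the coefficient of `θ` to be
recovered from `θ`. -/
theorem exists_dLocalParam_eq_one {p x : S} (hx : x ∈ (chartAt ℂ p).source) :
    ∃ v, dLocalParam p x v = 1 := by
  have : IsManifold 𝓘(ℂ) 1 S := .of_le (n := ω) le_top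
  have hx' : x ∈ (extChartAt 𝓘(ℂ) p).source := by simpa using hx
  have hd : MDifferentiableAt 𝓘(ℂ) 𝓘(ℂ) (chartAt ℂ p) x :=
    (contMDiffAt_of_mem_maximalAtlas (n := 1) (IsManifold.chart_mem_maximalAtlas p)
      hx).mdifferentiableAt one_ne_zero
  obtain ⟨v, hv⟩ := (isInvertible_mfderiv_extChartAt hx').bijective.2
    ((NormedSpace.fromTangentSpace (𝕜 := ℂ) (extChartAt 𝓘(ℂ) p x)).symm 1)
  refine ⟨v, ?_⟩
  have e : dLocalParam p x = mvfderiv 𝓘(ℂ) (extChartAt 𝓘(ℂ) p) x := by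
    have := mvfderiv_fun_sub hd (mdifferentiableAt_const (c := chartAt ℂ p p))
    rw [mvfderiv_const, sub_zero] at this
    exact this
  rw [e, mvfderiv, ContinuousLinearMap.comp_apply, hv]
  exact ContinuousLinearEquiv.apply_symm_apply _ _

end LocalParameter

/-! ### Holomorphic sections of line bundles and division by the local parameter -/

section LineBundle

variable {S : Type*} [TopologicalSpace S] [ChartedSpace ℂ S]
  {L : S → Type*} [∀ x, AddCommGroup (L x)]
  [∀ x, TopologicalSpace (L x)] [TopologicalSpace (Bundle.TotalSpace ℂ L)] [FiberBundle ℂ L]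

theorem HolAt.congr {s s' : ∀ x, L x} {p : S} (h : HolAt L s p) (hs : ∀ᶠ x in 𝓝 p, s' x = s x) :
    HolAt L s' p :=
  ContMDiffAt.congr_of_eventuallyEq h (hs.mono fun x hx => by simp only [hx])

theorem holAt_iff (s : ∀ x, L x) (p : S) : HolAt L s p ↔
    ContMDiffAt 𝓘(ℂ) 𝓘(ℂ) ω (fun x => (trivializationAt ℂ L p ⟨x, s x⟩).2) p :=
  Bundle.contMDiffAt_section p

variable [∀ x, Module ℂ (L x)] [VectorBundle ℂ ℂ L]

theorem holAt_zero (p : S) : HolAt L (fun x => (0 : L x)) p :=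
  Bundle.contMDiffAt_zeroSection ℂ L

theorem HolAt.smul [ContMDiffVectorBundle ω ℂ L 𝓘(ℂ)] {f : S → ℂ} {s : ∀ x, L x} {p : S}
    (hf : ContMDiffAt 𝓘(ℂ) 𝓘(ℂ) ω f p) (hs : HolAt L s p) : HolAt L (fun x => f x • s x) p :=
  ContMDiffAt.smul_section hf hs

theorem HolAt.eventually [IsManifold 𝓘(ℂ) ω S] [ContMDiffVectorBundle ω ℂ L 𝓘(ℂ)]
    {s : ∀ x, L x} {p : S} (hs : HolAt L s p) :
    ∀ᶠ x in 𝓝 p, HolAt L s x :=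
  (contMDiffAt_iff_contMDiffAt_nhds (by simp)).1 hs

/-- The coordinate of an element of a fibre in the preferred trivialization at `p`. -/
def fibreCoord (L : S → Type*) [∀ x, AddCommGroup (L x)] [∀ x, Module ℂ (L x)]
    [∀ x, TopologicalSpace (L x)] [TopologicalSpace (Bundle.TotalSpace ℂ L)] [FiberBundle ℂ L]
    [VectorBundle ℂ ℂ L] (p : S) : L p ≃ₗ[ℂ] ℂ :=
  (trivializationAt ℂ L p).linearEquivAt ℂ p (FiberBundle.mem_baseSet_trivializationAt' p)

/-- The local frame of a line bundle given by the preferred trivialization at `p`. -/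
def lineFrame (L : S → Type*) [∀ x, AddCommGroup (L x)] [∀ x, Module ℂ (L x)]
    [∀ x, TopologicalSpace (L x)] [TopologicalSpace (Bundle.TotalSpace ℂ L)] [FiberBundle ℂ L]
    (p x : S) : L x :=
  (trivializationAt ℂ L p).symm x 1

theorem fibreCoord_symm_one (p : S) : (fibreCoord L p).symm 1 = lineFrame L p p :=
  rfl

theorem eventually_mem_baseSet (L : S → Type*) [∀ x, AddCommGroup (L x)] [∀ x, Module ℂ (L x)]
    [∀ x, TopologicalSpace (L x)] [TopologicalSpace (Bundle.TotalSpace ℂ L)] [FiberBundle ℂ L]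
    (p : S) : ∀ᶠ x in 𝓝 p, x ∈ (trivializationAt ℂ L p).baseSet :=
  (trivializationAt ℂ L p).open_baseSet.mem_nhds (FiberBundle.mem_baseSet_trivializationAt' p)

theorem trivializationAt_symm_snd {p x : S} (hx : x ∈ (trivializationAt ℂ L p).baseSet) (z : ℂ) :
    (trivializationAt ℂ L p ⟨x, (trivializationAt ℂ L p).symm x z⟩).2 = z := by
  rw [(trivializationAt ℂ L p).apply_mk_symm hx]

theorem holAt_symm {f : S → ℂ} {p : S} (hf : ContMDiffAt 𝓘(ℂ) 𝓘(ℂ) ω f p) :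
    HolAt L (fun x => (trivializationAt ℂ L p).symm x (f x)) p := by
  rw [holAt_iff]
  refine hf.congr_of_eventuallyEq ?_
  filter_upwards [eventually_mem_baseSet L p] with x hx
  exact trivializationAt_symm_snd hx _

theorem holAt_lineFrame (p : S) : HolAt L (lineFrame L p) p :=
  holAt_symm contMDiffAt_const

theorem eq_zero_of_continuousAt_of_eventually_nhdsNE {f : S → ℂ} {p : S} (hf : ContinuousAt f p)
    (h : ∀ᶠ x in 𝓝[≠] p, f x = 0) : f p = 0 := by
  have := nhdsNE_neBot_of_chartedSpace p
  exact tendsto_nhds_unique (hf.tendsto.mono_left nhdsWithin_le_nhds)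
    (tendsto_const_nhds.congr' (h.mono fun x hx => hx.symm))

theorem HolAt.eq_zero_of_eventually_nhdsNE {s : ∀ x, L x} {p : S} (hs : HolAt L s p)
    (h : ∀ᶠ x in 𝓝[≠] p, s x = 0) : s p = 0 := by
  rw [holAt_iff] at hs
  have h0 := eq_zero_of_continuousAt_of_eventually_nhdsNE hs.continuousAt (by
    filter_upwards [h, nhdsWithin_le_nhds (eventually_mem_baseSet L p)] with x hx hxb
    rw [hx, ← (trivializationAt ℂ L p).linearEquivAt_apply (R := ℂ) x hxb, map_zero])
  exact (fibreCoord L p).map_eq_zero_iff.1 h0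

/-- A holomorphic function vanishing at `p` is divisible by the local parameter. -/
theorem exists_eventually_eq_localParam_mul [IsManifold 𝓘(ℂ) ω S] {f : S → ℂ} {p : S}
    (hf : ContMDiffAt 𝓘(ℂ) 𝓘(ℂ) ω f p) (h0 : f p = 0) :
    ∃ g : S → ℂ, ContMDiffAt 𝓘(ℂ) 𝓘(ℂ) ω g p ∧ ∀ᶠ x in 𝓝 p, f x = localParam p x * g x := by
  set φ := chartAt ℂ p
  have hp : p ∈ φ.source := mem_chart_source ℂ p
  have hsymm : ContMDiffAt 𝓘(ℂ) 𝓘(ℂ) ω φ.symm (φ p) :=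
    contMDiffAt_symm_of_mem_maximalAtlas (IsManifold.chart_mem_maximalAtlas p) (φ.map_source hp)
  have hF : ContMDiffAt 𝓘(ℂ) 𝓘(ℂ) ω (f ∘ φ.symm) (φ p) :=
    ContMDiffAt.comp _ (by rwa [φ.left_inv hp]) hsymm
  rw [contMDiffAt_iff_contDiffAt] at hF
  -- The quotient is the divided difference in the chart; its power series is that of `f ∘ φ.symm`
  -- shifted by one.
  have hG : AnalyticAt ℂ (dslope (f ∘ φ.symm) (φ p)) (φ p) := by
    obtain ⟨P, hP⟩ := hF.analyticAt
    exact ⟨_, hP.has_fpower_series_dslope_fslope⟩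
  refine ⟨dslope (f ∘ φ.symm) (φ p) ∘ φ, ContMDiffAt.comp p hG.contDiffAt.contMDiffAt
    (contMDiffAt_of_mem_maximalAtlas (IsManifold.chart_mem_maximalAtlas p) hp), ?_⟩
  filter_upwards [φ.open_source.mem_nhds hp] with x hx
  have := sub_smul_dslope (f ∘ φ.symm) (φ p) (φ x)
  simp only [Function.comp_apply, φ.left_inv hx, φ.left_inv hp, h0, sub_zero, smul_eq_mul] at this
  exact this.symm

theorem HolAt.exists_eventually_eq_localParam_smul [IsManifold 𝓘(ℂ) ω S] {s : ∀ x, L x} {p : S}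
    (hs : HolAt L s p) (h0 : s p = 0) :
    ∃ e, HolAt L e p ∧ ∀ᶠ x in 𝓝 p, s x = localParam p x • e x := by
  rw [holAt_iff] at hs
  obtain ⟨g, hg, hgs⟩ := exists_eventually_eq_localParam_mul hs
    ((fibreCoord L p).map_eq_zero_iff.2 h0)
  refine ⟨_, holAt_symm hg, ?_⟩
  filter_upwards [hgs, eventually_mem_baseSet L p] with x hx hxb
  refine ((trivializationAt ℂ L p).linearEquivAt ℂ x hxb).injective ?_
  rw [map_smul, (trivializationAt ℂ L p).linearEquivAt_apply (R := ℂ) x hxb, hx,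
    (trivializationAt ℂ L p).linearEquivAt_apply (R := ℂ) x hxb, trivializationAt_symm_snd hxb,
    smul_eq_mul]

variable [T2Space S] [IsManifold 𝓘(ℂ) ω S] [ContMDiffVectorBundle ω ℂ L 𝓘(ℂ)]

/-- The sections of `L(-Z)` are the sections of `L` vanishing on `Z`. -/
theorem mem_idealTwist_iff {Z U : Set S} (hZ : Z.Finite) (hU : IsOpen U) (s : ∀ x, L x) :
    s ∈ idealTwist L Z U ↔ (∀ p ∈ U, HolAt L s p) ∧ ∀ p ∈ U, p ∈ Z → s p = 0 := by
  constructor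
  · intro hs
    refine ⟨fun p hp => ?_, fun p hp hpZ => ?_⟩ <;>
      obtain ⟨V, -, hV, hpV, f, hf, e, he, hfe⟩ := hs p hp
    · refine ((he p hpV).smul (hf.1 p hpV)).congr ?_
      filter_upwards [hV.mem_nhds hpV] with x hx using hfe x hx
    · rw [hfe p hpV, hf.2 p hpV hpZ, zero_smul]
  · rintro ⟨hs, h0⟩ p hp
    -- Since `Z` is finite, `U` can be shrunk until `p` is the only possible point of `Z`. The
    -- factor in the ideal sheaf is then `t` if `p ∈ Z` and `1` if not.
    have hV' : IsOpen (U ∩ (Z \ {p})ᶜ) :=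
      hU.inter (hZ.subset Set.sdiff_subset).isClosed.isOpen_compl
    have hpV' : p ∈ U ∩ (Z \ {p})ᶜ := ⟨hp, fun h => h.2 rfl⟩
    by_cases hpZ : p ∈ Z
    · obtain ⟨e, he, hse⟩ := (hs p hp).exists_eventually_eq_localParam_smul (h0 p hp hpZ)
      obtain ⟨W, hW, hWo, hpW⟩ := eventually_nhds_iff.1 (hse.and (he.eventually.and
        ((chartAt ℂ p).open_source.mem_nhds (mem_chart_source ℂ p))))
      refine ⟨W ∩ (U ∩ (Z \ {p})ᶜ), fun x hx => hx.2.1, hWo.inter hV', ⟨hpW, hpV'⟩,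
        localParam p, ⟨fun x hx => contMDiffAt_localParam (hW x hx.1).2.2, fun x hx hxZ => ?_⟩,
        e, fun x hx => (hW x hx.1).2.1, fun x hx => (hW x hx.1).1⟩
      have : x = p := by_contra fun h => hx.2.2 ⟨hxZ, h⟩
      rw [this, localParam_self]
    · refine ⟨_, Set.inter_subset_left, hV', hpV', fun _ => 1,
        ⟨fun x _ => contMDiffAt_const, fun x hx hxZ => ?_⟩, s, fun x hx => hs x hx.1,
        fun x _ => (one_smul ℂ _).symm⟩
      exact (hx.2 ⟨hxZ, fun h => hpZ (h ▸ hxZ)⟩).elim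

end LineBundle

/-! ### The residue and the graded pieces of the complex -/

section HiggsResidue

variable {S : Type*} [TopologicalSpace S] [ChartedSpace ℂ S]
  {E : Fin 4 → S → Type*} [∀ q x, AddCommGroup (E q x)] [∀ q x, Module ℂ (E q x)]
  [∀ q x, TopologicalSpace (E q x)] [∀ q, TopologicalSpace (Bundle.TotalSpace ℂ (E q))]
  [∀ q, FiberBundle ℂ (E q)] [∀ q, VectorBundle ℂ ℂ (E q)]

theorem holAtSum_single_iff {q : Fin 4} {s : ∀ x, E q x} {p : S} :
    HolAtSum E (fun x => (Pi.single q (s x) : ∀ q, E q x)) p ↔ HolAt (E q) s p := by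
  refine ⟨fun h => by simpa using h q, fun h q' => ?_⟩
  by_cases hq : q' = q
  · subst hq
    simpa using h
  · simpa [Pi.single_eq_of_ne hq] using holAt_zero p

variable (E) in
/-- The basis of the fibre of `⨁ q, E q` at `p` given by the preferred trivializations at `p`. -/
def fibreBasis (p : S) : Module.Basis (Fin 4) ℂ (∀ q, E q p) :=
  Module.Basis.ofEquivFun (LinearEquiv.piCongrRight fun q => fibreCoord (E q) p)

theorem fibreBasis_repr_eq_zero_iff {p : S} {v : ∀ q, E q p} {q : Fin 4} :
    (fibreBasis E p).repr v q = 0 ↔ v q = 0 :=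
  (fibreCoord (E q) p).map_eq_zero_iff

theorem fibreBasis_apply (p : S) (q : Fin 4) :
    fibreBasis E p q = Pi.single q (lineFrame (E q) p p) := by
  refine (fibreBasis E p).repr.injective (Finsupp.ext fun q' => ?_)
  rw [Module.Basis.repr_self]
  change _ = fibreCoord (E q') p ((Pi.single q (lineFrame (E q) p p) : ∀ q, E q p) q')
  by_cases hq : q' = q
  · subst hq
    rw [Pi.single_eq_same, ← fibreCoord_symm_one, LinearEquiv.apply_symm_apply,
      Finsupp.single_eq_same]
  · rw [Pi.single_eq_of_ne hq, map_zero, Finsupp.single_eq_of_ne hq]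

namespace LogHiggsBundle

variable {D : Set S} (H : LogHiggsBundle D E)

/-- The points where the elements of `W₀` vanish in the `q`-th summand. -/
def zeroPoints (q : Fin 4) : Set S :=
  ![H.pointsII ∪ H.pointsIII, H.pointsI ∪ H.pointsIII, H.pointsII, ∅] q

/-- The points where `W₋₂` contains the `q`-th summand. -/
def polePoints (q : Fin 4) : Set S := ![∅, ∅, ∅, H.pointsIII] q

theorem zeroPoints_subset (q : Fin 4) : H.zeroPoints q ⊆ D := by
  fin_cases q
  · exact Set.union_subset (fun _ h => h.1) fun _ h => h.1
  · exact Set.union_subset (fun _ h => h.1) fun _ h => h.1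
  · exact fun _ h => h.1
  · exact Set.empty_subset _

theorem polePoints_subset (q : Fin 4) : H.polePoints q ⊆ D := by
  fin_cases q
  · exact Set.empty_subset _
  · exact Set.empty_subset _
  · exact Set.empty_subset _
  · exact fun _ h => h.1

variable [T2Space S] [IsManifold 𝓘(ℂ) ω S]

/-- Near `p ∈ D`, the endomorphism `A` with `θ = A ⊗ dt / t` is a value of `θ` outside `D`. -/
theorem eventually_exists_coeff_eq (hD : D.Finite) {p : S} (hp : p ∈ D) :
    ∀ᶠ x in 𝓝[≠] p, x ∉ D ∧
      ∃ v, (H.exists_coeff p).choose x = H.θ x v := by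
  have h1 : ∀ᶠ x in 𝓝 p, x ∉ D \ {p} :=
    (hD.subset Set.sdiff_subset).isClosed.isOpen_compl.mem_nhds fun h => h.2 rfl
  have h2 : ∀ᶠ x in 𝓝 p, x ∈ (chartAt ℂ p).source :=
    (chartAt ℂ p).open_source.mem_nhds (mem_chart_source ℂ p)
  filter_upwards [nhdsWithin_le_nhds (H.exists_coeff p).choose_spec.2, nhdsWithin_le_nhds h1,
    nhdsWithin_le_nhds h2, self_mem_nhdsWithin] with x hx hxD hxs hxp
  have hxD' : x ∉ D := fun h => hxD ⟨h, hxp⟩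
  refine ⟨hxD', ?_⟩
  obtain ⟨v, hv⟩ := exists_dLocalParam_eq_one hxs
  -- With `dt v = 1`, the form `dt / t` takes the value `1` on `t • v`.
  refine ⟨localParam p x • v, ?_⟩
  rw [map_smul, hx hxD' v, formGenerator, if_pos hp, hv, smul_smul,
    mul_one_div_cancel (localParam_ne_zero hxs hxp), one_smul]

/-- Transversality and skewness are given only off `D`. Evaluated on the local frame at `p` they say
that holomorphic expressions vanish on a punctured neighbourhood, hence at `p`. -/
theorem exists_isSelfDualShift_residue (hD : D.Finite) (hH : H.IsSelfDual) {p : S} (hp : p ∈ D) :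
    ∃ a β c : ℂ, IsSelfDualShift (fibreBasis E p) (H.residue p) a β c := by
  obtain ⟨Q, hQhol, hQnd, hQ0, hQθ⟩ := hH
  have hA := (H.exists_coeff p).choose_spec.1
  have hev := H.eventually_exists_coeff_eq hD hp
  have hframe : ∀ q, HolAtSum E
      (fun x => (Pi.single q (lineFrame (E q) p x) : ∀ q, E q x)) p := fun q =>
    holAtSum_single_iff.2 (holAt_lineFrame p)
  refine exists_isSelfDualShift (fibreBasis E p) (H.residue p) (fun q q' hq => ?_) (Q p)
    (hQnd p) (fun q q' hq => ?_) fun v w => ?_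
  · rw [fibreBasis_repr_eq_zero_iff, fibreBasis_apply]
    refine (hA _ (hframe q) q').eq_zero_of_eventually_nhdsNE ?_
    filter_upwards [hev] with x hx
    obtain ⟨hxD, v, hv⟩ := hx
    rw [hv]
    exact H.transversal x hxD v q _ q' hq
  · rw [fibreBasis_apply, fibreBasis_apply]
    exact hQ0 p q q' _ _ hq
  -- As an identity of bilinear forms, skewness can be tested on basis vectors, which extend to the
  -- holomorphic frame.
  · have hb : (Q p).comp (H.residue p) LinearMap.id + (Q p).comp LinearMap.id (H.residue p) = 0 := by
      refine LinearMap.BilinForm.ext_basis (fibreBasis E p) fun q q' => ?_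
      rw [fibreBasis_apply, fibreBasis_apply]
      have hzero := eq_zero_of_continuousAt_of_eventually_nhdsNE
        ((hQhol p _ _ (hA _ (hframe q)) (hframe q')).add
          (hQhol p _ _ (hframe q) (hA _ (hframe q')))).continuousAt (by
        filter_upwards [hev] with x hx
        obtain ⟨hxD, v, hv⟩ := hx
        rw [Pi.add_apply, hv]
        exact hQθ x hxD v _ _)
      exact hzero
    exact congrArg (fun B : LinearMap.BilinForm ℂ (∀ q, E q p) => B v w) hb

/-- The coordinate conditions in terms of types: `a ≠ 0` means II or III, `β ≠ 0` means I or III,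
and `a ≠ 0` with `β = 0` means II. -/
theorem mem_weightFiltration_residue_zero_iff (hD : D.Finite) (hH : H.IsSelfDual) {p : S}
    (hp : p ∈ D) (v : ∀ q, E q p) :
    v ∈ weightFiltration (H.residue p) 0 ↔ ∀ q, p ∈ H.zeroPoints q → v q = 0 := by
  obtain ⟨a, β, c, h⟩ := H.exists_isSelfDualShift_residue hD hH hp
  have hI : p ∈ H.pointsI ↔ a = 0 ∧ β ≠ 0 := (and_iff_right hp).trans h.isTypeI_iff
  have hII : p ∈ H.pointsII ↔ a ≠ 0 ∧ β = 0 := (and_iff_right hp).trans h.isTypeII_iff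
  have hIII : p ∈ H.pointsIII ↔ a ≠ 0 ∧ β ≠ 0 := (and_iff_right hp).trans h.isTypeIII_iff
  rw [h.mem_weightFiltration_zero_iff]
  simp only [fibreBasis_repr_eq_zero_iff]
  have e0 : p ∈ H.zeroPoints 0 ↔ a ≠ 0 := by
    change p ∈ H.pointsII ∪ H.pointsIII ↔ _
    rw [Set.mem_union, hII, hIII]
    by_cases hβ : β = 0 <;> simp [hβ]
  have e1 : p ∈ H.zeroPoints 1 ↔ β ≠ 0 := by
    change p ∈ H.pointsI ∪ H.pointsIII ↔ _
    rw [Set.mem_union, hI, hIII]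
    by_cases ha : a = 0 <;> simp [ha]
  have e2 : p ∈ H.zeroPoints 2 ↔ a ≠ 0 ∧ β = 0 := hII
  have e3 : p ∈ H.zeroPoints 3 ↔ False := Iff.rfl
  simp only [Fin.forall_fin_succ, Fin.forall_fin_zero]
  change _ ↔ (p ∈ H.zeroPoints 0 → v 0 = 0) ∧ (p ∈ H.zeroPoints 1 → v 1 = 0) ∧
    (p ∈ H.zeroPoints 2 → v 2 = 0) ∧ (p ∈ H.zeroPoints 3 → v 3 = 0) ∧ True
  rw [e0, e1, e2, e3]
  simp only [and_imp, false_imp_iff, and_true]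

theorem mem_weightFiltration_residue_neg_two_iff (hD : D.Finite) (hH : H.IsSelfDual) {p : S}
    (hp : p ∈ D) (v : ∀ q, E q p) :
    v ∈ weightFiltration (H.residue p) (-2) ↔ ∀ q, p ∉ H.polePoints q → v q = 0 := by
  obtain ⟨a, β, c, h⟩ := H.exists_isSelfDualShift_residue hD hH hp
  have hIII : p ∈ H.pointsIII ↔ a ≠ 0 ∧ β ≠ 0 := (and_iff_right hp).trans h.isTypeIII_iff
  rw [h.mem_weightFiltration_neg_two_iff, ← hIII]
  simp only [fibreBasis_repr_eq_zero_iff, Fin.forall_fin_succ, Fin.forall_fin_zero]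
  change _ ↔ (p ∉ (∅ : Set S) → v 0 = 0) ∧ (p ∉ (∅ : Set S) → v 1 = 0) ∧
    (p ∉ (∅ : Set S) → v 2 = 0) ∧ (p ∉ H.pointsIII → v 3 = 0) ∧ True
  simp

/-- Because `W₀` is a sum of graded lines, membership decouples into one condition per summand; this
is the source of the direct sum decomposition. -/
theorem mem_L2Zero_iff (hD : D.Finite) (hH : H.IsSelfDual) {U : Set S} {s : ∀ x q, E q x} :
    s ∈ H.L2Zero U ↔ ∀ q, (∀ p ∈ U, HolAt (E q) (fun x => s x q) p) ∧
      ∀ p ∈ U, p ∈ H.zeroPoints q → s p q = 0 := by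
  constructor
  · rintro ⟨hs, h0⟩ q
    refine ⟨fun p hp => hs p hp q, fun p hp hpZ => ?_⟩
    have hpD := H.zeroPoints_subset q hpZ
    exact (H.mem_weightFiltration_residue_zero_iff hD hH hpD _).1 (h0 p hp hpD) q hpZ
  · intro h
    exact ⟨fun p hp q => (h q).1 p hp, fun p hp hpD =>
      (H.mem_weightFiltration_residue_zero_iff hD hH hpD _).2 fun q hq => (h q).2 p hp hq⟩

theorem mem_L2ZeroPiece_iff (hD : D.Finite) (hH : H.IsSelfDual) {U : Set S} {q : Fin 4}
    {s : ∀ x, E q x} : s ∈ H.L2ZeroPiece q U ↔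
      (∀ p ∈ U, HolAt (E q) s p) ∧ ∀ p ∈ U, p ∈ H.zeroPoints q → s p = 0 := by
  change _ ∈ H.L2Zero U ↔ _
  rw [H.mem_L2Zero_iff hD hH]
  refine ⟨fun h => by simpa using h q, fun h q' => ?_⟩
  by_cases hq : q' = q
  · subst hq
    simpa using h
  · simp only [Pi.single_eq_of_ne hq]
    exact ⟨fun p _ => holAt_zero p, fun _ _ _ => trivial⟩

theorem L2ZeroPiece_eq_idealTwist [∀ q, ContMDiffVectorBundle ω ℂ (E q) 𝓘(ℂ)] (hD : D.Finite)
    (hH : H.IsSelfDual) {U : Set S} (hU : IsOpen U) (q : Fin 4) :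
    H.L2ZeroPiece q U = idealTwist (E q) (H.zeroPoints q) U := by
  ext s
  rw [H.mem_L2ZeroPiece_iff hD hH, mem_idealTwist_iff (hD.subset (H.zeroPoints_subset q)) hU]

/-- The local condition defining `L2One`, in the `q`-th summand. -/
theorem mem_L2One_iff (hD : D.Finite) (hH : H.IsSelfDual) {U : Set S}
    {σ : ∀ x, TangentSpace 𝓘(ℂ) x →ₗ[ℂ] ∀ q, E q x} :
    σ ∈ H.L2One U ↔ ∀ q, ∀ p ∈ U, ∃ e : ∀ x, E q x, HolAt (E q) e p ∧
      (p ∈ D → p ∉ H.polePoints q → e p = 0) ∧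
      ∀ᶠ x in 𝓝 p, x ∉ D → ∀ v, σ x v q = formGenerator D p x v • e x := by
  constructor
  · intro h q p hp
    obtain ⟨e, he, hW, hσ⟩ := h p hp
    refine ⟨fun x => e x q, he q, fun hpD hpq =>
      (H.mem_weightFiltration_residue_neg_two_iff hD hH hpD _).1 (hW hpD) q hpq, ?_⟩
    filter_upwards [hσ] with x hx hxD v
    rw [hx hxD v, Pi.smul_apply]
  · intro h p hp
    choose e he h0 hσ using fun q => h q p hp
    refine ⟨fun x q => e q x, he, fun hpD =>
      (H.mem_weightFiltration_residue_neg_two_iff hD hH hpD _).2 fun q hq => h0 q hpD hq, ?_⟩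
    filter_upwards [Filter.eventually_all.2 hσ] with x hx hxD v
    funext q
    exact hx q hxD v

theorem mem_L2OnePiece_iff (hD : D.Finite) (hH : H.IsSelfDual) {U : Set S} {q : Fin 4}
    {σ : ∀ x, TangentSpace 𝓘(ℂ) x →ₗ[ℂ] E q x} :
    σ ∈ H.L2OnePiece q U ↔ ∀ p ∈ U, ∃ e : ∀ x, E q x, HolAt (E q) e p ∧
      (p ∈ D → p ∉ H.polePoints q → e p = 0) ∧
      ∀ᶠ x in 𝓝 p, x ∉ D → ∀ v, σ x v = formGenerator D p x v • e x := by
  change _ ∈ H.L2One U ↔ _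
  rw [H.mem_L2One_iff hD hH]
  refine ⟨fun h => by simpa using h q, fun h q' => ?_⟩
  by_cases hq : q' = q
  · subst hq
    simpa using h
  · intro p _
    exact ⟨_, holAt_zero p, fun _ _ => rfl,
      Filter.Eventually.of_forall fun x _ v => by simp [Pi.single_eq_of_ne hq]⟩

/-- The local conditions agree point by point. At a pole point both use `dt / t` with no condition
on `e`, and off `D` both use `dt`. At the remaining points of `D`, `e p = 0` means `e = t • e'`, and
`t * (dt / t) = dt`. -/
theorem L2OnePiece_eq_twistedForms [∀ q, ContMDiffVectorBundle ω ℂ (E q) 𝓘(ℂ)] (hD : D.Finite)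
    (hH : H.IsSelfDual) (U : Set S) (q : Fin 4) :
    H.L2OnePiece q U = twistedForms (E q) D (H.polePoints q) U := by
  ext σ
  rw [H.mem_L2OnePiece_iff hD hH]
  refine forall₂_congr fun p _ => ?_
  by_cases hpD : p ∈ D
  · by_cases hpY : p ∈ H.polePoints q
    · simp [formGenerator, hpD, hpY]
    · have hsource : ∀ᶠ x in 𝓝 p, x ∈ (chartAt ℂ p).source :=
        (chartAt ℂ p).open_source.mem_nhds (mem_chart_source ℂ p)
      have hgen : ∀ x ∈ (chartAt ℂ p).source, x ∉ D → ∀ v, ∀ u : E q x,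
          formGenerator D p x v • localParam p x • u =
            formGenerator (H.polePoints q) p x v • u := by
        intro x hx hxD v u
        rw [formGenerator, formGenerator, if_pos hpD, if_neg hpY, smul_smul,
          div_mul_cancel₀ _ (localParam_ne_zero hx fun h => hxD (h ▸ hpD))]
      constructor
      · rintro ⟨e, he, h0, hσ⟩
        obtain ⟨e', he', hee'⟩ := he.exists_eventually_eq_localParam_smul (h0 hpD hpY)
        refine ⟨e', he', ?_⟩
        filter_upwards [hσ, hee', hsource] with x hx hxe hxs hxD v
        rw [hx hxD v, hxe, hgen x hxs hxD]
      · rintro ⟨e, he, hσ⟩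
        refine ⟨fun x => localParam p x • e x,
          he.smul (contMDiffAt_localParam (mem_chart_source ℂ p)), fun _ _ => ?_, ?_⟩
        · change localParam p p • e p = 0
          rw [localParam_self, zero_smul]
        · filter_upwards [hσ, hsource] with x hx hxs hxD v
          rw [hx hxD v, hgen x hxs hxD]
  · have hpY : p ∉ H.polePoints q := fun h => hpD (H.polePoints_subset q h)
    simp [formGenerator, hpD, hpY]

end LogHiggsBundle

end HiggsResidue

end

/-! ### The theorem -/

theorem mainTheorem3 {S : Type*} [TopologicalSpace S] [T2Space S] [CompactSpace S]
    [ConnectedSpace S] [ChartedSpace ℂ S] [IsManifold 𝓘(ℂ) ω S]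
    (E : Fin 4 → S → Type*) [∀ q x, AddCommGroup (E q x)] [∀ q x, Module ℂ (E q x)]
    [∀ q x, TopologicalSpace (E q x)] [∀ q, TopologicalSpace (Bundle.TotalSpace ℂ (E q))]
    [∀ q, FiberBundle ℂ (E q)] [∀ q, VectorBundle ℂ ℂ (E q)]
    [∀ q, ContMDiffVectorBundle ω ℂ (E q) 𝓘(ℂ)]
    (D : Set S) (hD : D.Finite) (H : LogHiggsBundle D E) (hH : H.IsSelfDual) :
    -- the possible residues
    (∀ p ∈ D, H.residue p ^ 4 = 0 ∧ ¬ (H.residue p ^ 2 ≠ 0 ∧ H.residue p ^ 3 = 0) ∧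
      (H.residue p = 0 ∨ p ∈ H.pointsI ∨ p ∈ H.pointsII ∨ p ∈ H.pointsIII)) ∧
    (Disjoint H.pointsI H.pointsII ∧ Disjoint H.pointsI H.pointsIII ∧
      Disjoint H.pointsII H.pointsIII) ∧
    ∀ U : Set S, IsOpen U →
      -- the complex is the direct sum of its graded pieces
      (∀ s, s ∈ H.L2Zero U ↔ ∀ q, (fun x => s x q) ∈ H.L2ZeroPiece q U) ∧
      (∀ σ, σ ∈ H.L2One U ↔ ∀ q, (fun x => LinearMap.proj q ∘ₗ σ x) ∈ H.L2OnePiece q U) ∧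
      -- the pieces in degree zero
      H.L2ZeroPiece 0 U = idealTwist (E 0) (H.pointsII ∪ H.pointsIII) U ∧
      H.L2ZeroPiece 1 U = idealTwist (E 1) (H.pointsI ∪ H.pointsIII) U ∧
      H.L2ZeroPiece 2 U = idealTwist (E 2) H.pointsII U ∧
      H.L2ZeroPiece 3 U = holSections (E 3) U ∧
      -- the pieces in degree one
      H.L2OnePiece 0 U = twistedForms (E 0) D ∅ U ∧
      H.L2OnePiece 1 U = twistedForms (E 1) D ∅ U ∧
      H.L2OnePiece 2 U = twistedForms (E 2) D ∅ U ∧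
      H.L2OnePiece 3 U = twistedForms (E 3) D H.pointsIII U := by
  have hres := fun p hp => H.exists_isSelfDualShift_residue hD hH (p := p) hp
  refine ⟨fun p hp => ?_, ⟨?_, ?_, ?_⟩, fun U hU => ⟨fun s => ?_, fun σ => ?_,
    H.L2ZeroPiece_eq_idealTwist hD hH hU 0, H.L2ZeroPiece_eq_idealTwist hD hH hU 1,
    H.L2ZeroPiece_eq_idealTwist hD hH hU 2, ?_, H.L2OnePiece_eq_twistedForms hD hH U 0,
    H.L2OnePiece_eq_twistedForms hD hH U 1, H.L2OnePiece_eq_twistedForms hD hH U 2,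
    H.L2OnePiece_eq_twistedForms hD hH U 3⟩⟩
  · obtain ⟨a, β, c, h⟩ := hres p hp
    refine ⟨h.pow_four, fun ⟨h2, h3⟩ => ?_, ?_⟩
    · by_cases hz : a = 0 ∨ β = 0
      · exact h2 (h.sq_eq_zero hz)
      · exact h.cube_ne_zero (fun ha => hz (Or.inl ha)) (fun hβ => hz (Or.inr hβ)) h3
    · rcases h.eq_zero_or_isType with h0 | h1 | h2 | h3
      · exact Or.inl h0
      · exact Or.inr (Or.inl ⟨hp, h1⟩)
      · exact Or.inr (Or.inr (Or.inl ⟨hp, h2⟩))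
      · exact Or.inr (Or.inr (Or.inr ⟨hp, h3⟩))
  · exact Set.disjoint_left.2 fun p h h' => h.2.not_isTypeII h'.2
  · exact Set.disjoint_left.2 fun p h h' => h.2.not_isTypeIII h'.2
  · exact Set.disjoint_left.2 fun p h h' => h.2.not_isTypeIII h'.2
  · simp only [H.mem_L2ZeroPiece_iff hD hH]
    exact H.mem_L2Zero_iff hD hH
  · simp only [H.mem_L2OnePiece_iff hD hH]
    exact H.mem_L2One_iff hD hH
  · ext s
    rw [H.mem_L2ZeroPiece_iff hD hH]
    -- `H.zeroPoints 3` is empty, so no vanishing is imposed on the last summand.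
    exact and_iff_left fun _ _ h => h.elim
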